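/- Let $r$ and $q$ be positive integers and let $\mathsf k$ be a field. For an ideal $J$ of a polynomial ring $R$ in finitely many variables over $\mathsf k$, the $i$-th Betti number $\beta_i^R(J)$ is the smallest possible rank of the free module $F_i$ in a free resolution $0\to F_t\to\cdots\to F_1\to F_0\to J\to 0$ of $J$ by free $R$-modules of finite rank. Let $$S_{\mathcal E}=\mathsf k[x_A : \emptyset\ne A\subseteq\{1,\dots,q\}]$$ be the polynomial ring in $2^q-1$ variables, let $\epsilon_j=\prod_{A\subseteq\{1,\dots,q\},\ j\in A}x_A$ for $1\le j\le q$, and let $\mathcal E_q=(\epsilon_1,\dots,\epsilon_q)\subseteq S_{\mathcal E}$ be the $q$-extremal ideal. Then for every $n\ge 0$, every ideal $I$ of $S=\mathsf k[x_1,\dots,x_n]$ that is minimally generated by $q$ square-free monomials (that is, generated by $q$ square-free monomials none of which can be omitted), and every $i\ge 0$, $$\beta_i^S(I^r)\le\beta_i^{S_{\mathcal E}}({\mathcal E_q}^r).$$ -/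

import Mathlib

open MvPolynomial

/-- A (finite) free resolution of an `R`-module `M`, i.e. an exact sequence
`0 → R^{β_t} → ⋯ → R^{β_1} → R^{β_0} → M → 0`.
The module in spot `j` is `R^{rank j}`; it is zero for all large `j`, so that exactness in every
spot includes the injectivity of the leftmost map. -/
structure FreeResolution (R : Type*) [CommRing R] (M : Type*) [AddCommGroup M] [Module R M] where
  /-- the rank `β_j` of the free module in spot `j` -/
  rank : ℕ → ℕ
  /-- the differential from spot `j + 1` to spot `j` -/
  d : ∀ j : ℕ, (Fin (rank (j + 1)) → R) →ₗ[R] (Fin (rank j) → R)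
  /-- the augmentation `R^{β_0} → M` -/
  aug : (Fin (rank 0) → R) →ₗ[R] M
  aug_surjective : Function.Surjective aug
  exact_zero : Function.Exact (d 0) aug
  exact_succ : ∀ j : ℕ, Function.Exact (d (j + 1)) (d j)
  finite_length : ∃ t : ℕ, ∀ j : ℕ, t < j → rank j = 0

/-- The `i`-th Betti number `β_i^R(M)`: the smallest possible rank of the free module in the
`i`-th spot of any free resolution of `M`.  (Over a polynomial ring over a field every finitely
generated module has a free resolution, so there the infimum is an attained minimum.  For a
homogeneous ideal all these minima are attained by one and the same resolution, the minimal one.) -/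
noncomputable def bettiNumber (R : Type*) [CommRing R] (M : Type*) [AddCommGroup M] [Module R M]
    (i : ℕ) : ℕ :=
  sInf {b : ℕ | ∃ F : FreeResolution R M, F.rank i = b}

/-- A square-free monomial: a product of pairwise distinct variables. -/
def IsSquarefreeMonomial {σ k : Type*} [CommRing k] (p : MvPolynomial σ k) : Prop :=
  ∃ s : Finset σ, p = ∏ x ∈ s, X x

/-- The ideal `I` is minimally generated by `q` square-free monomials `m_1, …, m_q`:
they generate `I`, and none of them can be left out. -/
def IsMinimallyGeneratedBySquarefreeMonomials {σ k : Type*} [CommRing k]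
    (I : Ideal (MvPolynomial σ k)) (q : ℕ) : Prop :=
  ∃ m : Fin q → MvPolynomial σ k,
    (∀ j, IsSquarefreeMonomial (m j)) ∧
    Ideal.span (Set.range m) = I ∧
    ∀ j, Ideal.span (m '' {j}ᶜ) ≠ I

/-- The index set of the variables `x_A`, `∅ ≠ A ⊆ [q]`. -/
abbrev ExtremalVar (q : ℕ) : Type := {A : Finset (Fin q) // A.Nonempty}

/-- The ring `S_E = k[x_A : ∅ ≠ A ⊆ [q]]`. -/
abbrev ExtremalRing (k : Type*) [Field k] (q : ℕ) : Type _ := MvPolynomial (ExtremalVar q) k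

/-- The square-free monomial `ε_i = ∏_{A ∋ i} x_A`. -/
noncomputable def extremalMonomial (k : Type*) [Field k] (q : ℕ) (i : Fin q) : ExtremalRing k q :=
  ∏ A : ExtremalVar q with i ∈ A.1, X A

/-- The `q`-extremal ideal `E_q = (ε_1, …, ε_q)`. -/
noncomputable def extremalIdeal (k : Type*) [Field k] (q : ℕ) : Ideal (ExtremalRing k q) :=
  Ideal.span (Set.range (extremalMonomial k q))


/-!
Give `x_A` the exponent vector of the product `m_A` of all variables that divide the generator `m_j`
exactly for `j ∈ A`. The substitution `x_A ↦ m_A` sends `ε_j` to `m_j`, hence `E_q ^ r` to `I ^ r`,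
and the supports of the `m_A` are pairwise disjoint. It factors as the flat extension that adjoins
the variables of `S`, followed by the quotients by the elements `x_A - m_A`, one after the other.
By disjointness of supports each `x_A - m_A` is regular on the ring and modulo the image of
`E_q ^ r`, so that every free resolution of `E_q ^ r` stays exact, with the same ranks, all the way
down to `S`. That such a resolution exists follows by adding the monomial generators one at a time:
the successive quotients are cyclic and their annihilators are monomial ideals with fewer
generators.
-/

universe u

open Function

/-- `M` has a resolution of finite length by free modules of finite rank. This inductive form of
the existence of a `FreeResolution` peels off one free module at a time, for use in inductions on
the length of the resolution. -/
inductive HasFiniteFreeResolution (R : Type u) [CommRing R] :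
    ∀ (M : Type u) [AddCommGroup M] [Module R M], Prop
  | of_subsingleton (M : Type u) [AddCommGroup M] [Module R M] [Subsingleton M] :
      HasFiniteFreeResolution R M
  | of_surjective {M : Type u} [AddCommGroup M] [Module R M] {n : ℕ} (f : (Fin n → R) →ₗ[R] M)
      (hf : Surjective f) (hker : HasFiniteFreeResolution R (LinearMap.ker f)) :
      HasFiniteFreeResolution R M

theorem exists_exact_ker_of_surjective {R : Type*} [Ring R] {A B C A' B' C' : Type*}
    [AddCommGroup A] [AddCommGroup B] [AddCommGroup C] [Module R A] [Module R B] [Module R C]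
    [AddCommGroup A'] [AddCommGroup B'] [AddCommGroup C'] [Module R A'] [Module R B'] [Module R C']
    {i : A →ₗ[R] B} {p : B →ₗ[R] C} {i' : A' →ₗ[R] B'} {p' : B' →ₗ[R] C'}
    {α : A →ₗ[R] A'} {β : B →ₗ[R] B'} {γ : C →ₗ[R] C'}
    (hi : Injective i) (hip : Exact i p) (hp : Surjective p)
    (hi' : Injective i') (hip' : Exact i' p')
    (hαβ : β ∘ₗ i = i' ∘ₗ α) (hβγ : γ ∘ₗ p = p' ∘ₗ β) (hα : Surjective α) :
    ∃ (j : LinearMap.ker α →ₗ[R] LinearMap.ker β) (s : LinearMap.ker β →ₗ[R] LinearMap.ker γ),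
      Injective j ∧ Exact j s ∧ Surjective s := by
  replace hαβ (a : A) : β (i a) = i' (α a) := LinearMap.congr_fun hαβ a
  replace hβγ (b : B) : γ (p b) = p' (β b) := LinearMap.congr_fun hβγ b
  refine ⟨i.restrict fun a (ha : α a = 0) ↦ ?_, p.restrict fun b (hb : β b = 0) ↦ ?_,
    fun a a' h ↦ Subtype.ext (hi congr($h)), ?_, ?_⟩
  · simp [hαβ, ha]
  · simp [hβγ, hb]
  · rintro ⟨b, hb⟩
    rw [LinearMap.mem_ker] at hb
    constructor
    · intro h
      obtain ⟨a, rfl⟩ := (hip b).1 congr($h)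
      have ha : α a = 0 := hi' (by rw [← hαβ, hb, map_zero])
      exact ⟨⟨a, ha⟩, rfl⟩
    · rintro ⟨a, ha⟩
      exact Subtype.ext ((hip b).2 ⟨a, congr($ha)⟩)
  · rintro ⟨c, hc⟩
    obtain ⟨b, rfl⟩ := hp c
    rw [LinearMap.mem_ker, hβγ] at hc
    obtain ⟨a', ha'⟩ := (hip' (β b)).1 hc
    obtain ⟨a, rfl⟩ := hα a'
    refine ⟨⟨b - i a, ?_⟩, Subtype.ext ?_⟩
    · simp [hαβ, ha']
    · change p (b - i a) = p b
      rw [map_sub, hip.apply_apply_eq_zero, sub_zero]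

namespace HasFiniteFreeResolution

variable {R : Type u} [CommRing R] {A B C M P : Type u} [AddCommGroup A] [Module R A]
  [AddCommGroup B] [Module R B] [AddCommGroup C] [Module R C] [AddCommGroup M] [Module R M]
  [AddCommGroup P] [Module R P]

theorem exists_surjective (h : HasFiniteFreeResolution R M) :
    ∃ (n : ℕ) (f : (Fin n → R) →ₗ[R] M),
      Surjective f ∧ HasFiniteFreeResolution R (LinearMap.ker f) := by
  cases h with
  | of_subsingleton => exact ⟨0, 0, surjective_to_subsingleton _, .of_subsingleton _⟩
  | of_surjective f hf hker => exact ⟨_, f, hf, hker⟩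

theorem of_equiv (e : A ≃ₗ[R] B) (h : HasFiniteFreeResolution R A) :
    HasFiniteFreeResolution R B := by
  obtain ⟨n, f, hf, hker⟩ := h.exists_surjective
  refine .of_surjective (e.toLinearMap ∘ₗ f) (e.surjective.comp hf) ?_
  rwa [LinearEquiv.ker_comp]

theorem of_surjective_of_free [Module.Free R P] [Module.Finite R P] (f : P →ₗ[R] M)
    (hf : Surjective f) (hker : HasFiniteFreeResolution R (LinearMap.ker f)) :
    HasFiniteFreeResolution R M := by
  have e : (Fin (Fintype.card (Module.Free.ChooseBasisIndex R P)) → R) ≃ₗ[R] P :=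
    ((Module.Free.chooseBasis R P).reindex (Fintype.equivFin _)).equivFun.symm
  refine .of_surjective (f ∘ₗ e.toLinearMap) (hf.comp e.surjective) ?_
  rw [LinearMap.ker_comp]
  exact hker.of_equiv (e.ofSubmodule' _).symm

/-- The horseshoe lemma. -/
theorem of_exact {i : A →ₗ[R] B} {p : B →ₗ[R] C} (hi : Injective i) (hip : Exact i p)
    (hp : Surjective p) (hA : HasFiniteFreeResolution R A) (hC : HasFiniteFreeResolution R C) :
    HasFiniteFreeResolution R B := by
  induction hA generalizing B C with
  | of_subsingleton A =>
    have hp_inj : Injective p := (injective_iff_map_eq_zero p).2 fun b hb ↦ by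
      obtain ⟨a, rfl⟩ := (hip b).1 hb
      rw [Subsingleton.elim a 0, map_zero]
    exact hC.of_equiv (LinearEquiv.ofBijective p ⟨hp_inj, hp⟩).symm
  | @of_surjective A _ _ m α hα _ ih =>
    obtain ⟨n, γ, hγ, hkerγ⟩ := hC.exists_surjective
    obtain ⟨γ', hγ'⟩ := Module.projective_lifting_property p γ hp
    let β : (Fin m → R) × (Fin n → R) →ₗ[R] B := (i ∘ₗ α).coprod γ'
    have hαβ : β ∘ₗ LinearMap.inl R _ _ = i ∘ₗ α := LinearMap.coprod_inl _ _
    have hβγ : γ ∘ₗ LinearMap.snd R _ _ = p ∘ₗ β := by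
      rw [LinearMap.comp_coprod, hγ', ← LinearMap.comp_assoc, hip.linearMap_comp_eq_zero]
      ext <;> simp
    have hβ : Surjective β := by
      intro b
      obtain ⟨y, hy⟩ := hγ (p b)
      obtain ⟨a, ha⟩ := (hip (b - γ' y)).1 <| by
        rw [map_sub, ← LinearMap.comp_apply, hγ', hy, sub_self]
      obtain ⟨x, rfl⟩ := hα a
      exact ⟨(x, y), by simp [β, ha]⟩
    obtain ⟨j, s, hj, hjs, hs⟩ := exists_exact_ker_of_surjective LinearMap.inl_injective
      Exact.inl_snd LinearMap.snd_surjective hi hip hαβ hβγ hα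
    exact .of_surjective_of_free β hβ (ih hj hjs hs hkerγ)

theorem sup_span_singleton {N : Submodule R M} {x : M} (hN : HasFiniteFreeResolution R N)
    (hx : HasFiniteFreeResolution R (N.comap (LinearMap.toSpanSingleton R M x))) :
    HasFiniteFreeResolution R ↥(N ⊔ Submodule.span R {x}) := by
  let i : N →ₗ[R] ↥(N ⊔ Submodule.span R {x}) := Submodule.inclusion le_sup_left
  let x' : ↥(N ⊔ Submodule.span R {x}) :=
    ⟨x, Submodule.mem_sup_right (Submodule.mem_span_singleton_self x)⟩
  have hi : Injective i := Submodule.inclusion_injective _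
  refine of_exact hi (LinearMap.exact_map_mkQ_range i) (Submodule.mkQ_surjective _) hN ?_
  let f : R →ₗ[R] _ ⧸ LinearMap.range i :=
    (LinearMap.range i).mkQ ∘ₗ LinearMap.toSpanSingleton R _ x'
  have hker : LinearMap.ker f = N.comap (LinearMap.toSpanSingleton R M x) := by
    ext r
    simp [f, i, x', Submodule.range_inclusion]
  have hf : Surjective f := by
    refine (Submodule.mkQ_surjective _).forall.2 fun ⟨y, hy⟩ ↦ ?_
    obtain ⟨n, hn, z, hz, rfl⟩ := Submodule.mem_sup.1 hy
    obtain ⟨r, rfl⟩ := Submodule.mem_span_singleton.1 hz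
    refine ⟨r, (Submodule.Quotient.eq _).2 ⟨⟨-n, neg_mem hn⟩, Subtype.ext ?_⟩⟩
    simp [i, x']
  exact of_surjective_of_free f hf (hker ▸ hx)

theorem nonempty_freeResolution (h : HasFiniteFreeResolution R M) :
    Nonempty (FreeResolution R M) := by
  induction h with
  | of_subsingleton M =>
    exact ⟨{
      rank := 0
      d _ := 0
      aug := 0
      aug_surjective := surjective_to_subsingleton _
      exact_zero _ := by simp [eq_iff_true_of_subsingleton]
      exact_succ _ _ := by simp [eq_iff_true_of_subsingleton]
      finite_length := ⟨0, fun _ _ ↦ rfl⟩ }⟩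
  | @of_surjective M _ _ n f hf _ ih =>
    obtain ⟨F⟩ := ih
    obtain ⟨t, ht⟩ := F.finite_length
    exact ⟨{
      rank
        | 0 => n
        | j + 1 => F.rank j
      d
        | 0 => (LinearMap.ker f).subtype ∘ₗ F.aug
        | j + 1 => F.d j
      aug := f
      aug_surjective := hf
      exact_zero x := by
        rw [← LinearMap.mem_ker, LinearMap.coe_comp, Set.range_comp, F.aug_surjective.range_eq]
        simp
      exact_succ
        | 0 => F.exact_zero.comp_injective _ (Subtype.val_injective) rfl
        | j + 1 => F.exact_succ j
      finite_length := ⟨t + 1, fun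
        | j + 1, hj => ht j (by omega)⟩ }⟩

end HasFiniteFreeResolution

/-- The ideal of `k[x_i : i ∈ σ]` generated by the monomials `x ^ e` with `e ∈ s`. -/
noncomputable def monomialIdeal {σ : Type*} (k : Type*) [CommSemiring k] (s : Set (σ →₀ ℕ)) :
    Ideal (MvPolynomial σ k) :=
  Ideal.span ((fun e ↦ monomial e 1) '' s)

section MonomialIdeal

variable {σ k : Type*}

theorem mem_monomialIdeal [CommSemiring k] {s : Set (σ →₀ ℕ)} {p : MvPolynomial σ k} :
    p ∈ monomialIdeal k s ↔ ∀ e ∈ p.support, ∃ g ∈ s, g ≤ e :=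
  mem_ideal_span_monomial_image

theorem monomialIdeal_empty [CommSemiring k] : monomialIdeal k (∅ : Set (σ →₀ ℕ)) = ⊥ := by
  simp [monomialIdeal]

theorem monomialIdeal_insert [CommSemiring k] (e : σ →₀ ℕ) (s : Set (σ →₀ ℕ)) :
    monomialIdeal k (insert e s) = monomialIdeal k s ⊔ Ideal.span {monomial e 1} := by
  rw [monomialIdeal, Set.image_insert_eq, Ideal.span_insert, sup_comm, monomialIdeal]

theorem comap_toSpanSingleton_monomialIdeal [CommSemiring k] (e : σ →₀ ℕ) (s : Set (σ →₀ ℕ)) :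
    Submodule.comap (LinearMap.toSpanSingleton (MvPolynomial σ k) _ (monomial e 1))
      (monomialIdeal k s) = monomialIdeal k ((· - e) '' s) := by
  ext p
  simp only [Submodule.mem_comap, LinearMap.toSpanSingleton_apply, smul_eq_mul, mem_monomialIdeal,
    Set.exists_mem_image, tsub_le_iff_right]
  constructor
  · intro h d hd
    refine h (d + e) ?_
    rwa [mem_support_iff, coeff_mul_monomial, mul_one, ← mem_support_iff]
  · intro h d hd
    rw [mem_support_iff, coeff_mul_monomial', mul_one, ite_ne_right_iff] at hd
    obtain ⟨g, hg, hgd⟩ := h (d - e) (mem_support_iff.2 hd.2)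
    exact ⟨g, hg, by rwa [tsub_add_cancel_of_le hd.1] at hgd⟩

theorem monomialIdeal_mul [CommSemiring k] (s t : Set (σ →₀ ℕ)) :
    monomialIdeal k s * monomialIdeal k t = monomialIdeal k (Set.image2 (· + ·) s t) := by
  simp only [monomialIdeal, Ideal.span_mul_span', ← Set.image2_mul, Set.image2_image_left,
    Set.image2_image_right, Set.image_image2, monomial_mul, one_mul]

theorem exists_monomialIdeal_pow_eq [CommSemiring k] {s : Set (σ →₀ ℕ)} (hs : s.Finite) (r : ℕ) :
    ∃ t : Set (σ →₀ ℕ), t.Finite ∧ monomialIdeal k s ^ r = monomialIdeal k t := by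
  induction r with
  | zero => exact ⟨{0}, Set.finite_singleton 0, by simp [monomialIdeal]⟩
  | succ r ih =>
    obtain ⟨t, ht, h⟩ := ih
    exact ⟨_, ht.image2 _ hs, by rw [pow_succ, h, monomialIdeal_mul]⟩

theorem hasFiniteFreeResolution_monomialIdeal [CommRing k] {s : Set (σ →₀ ℕ)} (hs : s.Finite) :
    HasFiniteFreeResolution (MvPolynomial σ k) (monomialIdeal k s) := by
  obtain ⟨n, e, -, rfl⟩ := hs.fin_param
  clear hs
  induction n with
  | zero =>
    rw [Set.range_eq_empty, monomialIdeal_empty]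
    exact .of_subsingleton _
  | succ n ih =>
    rw [← Fin.cons_self_tail e, Fin.range_cons, monomialIdeal_insert]
    refine .sup_span_singleton (ih _) ?_
    rw [comap_toSpanSingleton_monomialIdeal, ← Set.range_comp]
    exact ih _

end MonomialIdeal

section BaseChange

open TensorProduct

variable {R S : Type*} [CommRing R] [CommRing S] (φ : R →+* S) {α β γ : Type*}
  [Fintype α] [DecidableEq α] [Fintype β] [DecidableEq β]

/-- The base change along `φ` of a linear map between finite free modules with chosen bases: the
entries of its matrix are mapped by `φ`. This avoids tensor products in the terms of a resolution,
which have to be of the form `Fin b → S`. -/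
noncomputable def piBaseChange (d : (α → R) →ₗ[R] (β → R)) : (α → S) →ₗ[S] (β → S) :=
  ((LinearMap.toMatrix' d).map φ).toLin'

omit [Fintype β] [DecidableEq β] in
theorem piBaseChange_comp_apply (d : (α → R) →ₗ[R] (β → R)) (z : α → R) :
    piBaseChange φ d (φ ∘ z) = φ ∘ d z := by
  ext i
  rw [piBaseChange, Matrix.toLin'_apply, ← RingHom.map_mulVec, LinearMap.toMatrix'_mulVec]
  rfl

omit [Fintype β] [DecidableEq β] in
theorem piScalarRight_one_tmul [Algebra R S] (z : α → R) :
    piScalarRight R S S α (1 ⊗ₜ z) = algebraMap R S ∘ z := by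
  ext i
  simp [Algebra.algebraMap_eq_smul_one]

theorem piBaseChange_comp_piScalarRight [Algebra R S] (d : (α → R) →ₗ[R] (β → R)) :
    piBaseChange (algebraMap R S) d ∘ₗ (piScalarRight R S S α).toLinearMap =
      (piScalarRight R S S β).toLinearMap ∘ₗ d.baseChange S := by
  ext i : 4
  simp only [TensorProduct.AlgebraTensorModule.curry_apply, LinearMap.restrictScalars_comp,
    TensorProduct.curry_apply, LinearMap.comp_apply, LinearMap.coe_restrictScalars,
    LinearEquiv.coe_coe, LinearMap.baseChange_tmul, piScalarRight_one_tmul,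
    piBaseChange_comp_apply]

variable {φ}

theorem exact_piBaseChange_of_flat [Finite γ] (hφ : φ.Flat) {d₁ : (α → R) →ₗ[R] (β → R)}
    {d₂ : (β → R) →ₗ[R] (γ → R)} (h : Exact d₁ d₂) :
    Exact (piBaseChange φ d₁) (piBaseChange φ d₂) := by
  classical
  have := Fintype.ofFinite γ
  algebraize [φ]
  have h_tensor : Exact (d₁.baseChange S) (d₂.baseChange S) := Module.Flat.lTensor_exact S h
  exact h_tensor.of_ladder_linearEquiv_of_exact (piBaseChange_comp_piScalarRight d₁)
    (piBaseChange_comp_piScalarRight d₂)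

theorem exact_piBaseChange_of_regular {N : Type*} [AddCommGroup N] [Module R N]
    (hφ : Surjective φ) {f : R} (hf : RingHom.ker φ = Ideal.span {f}) (hN : IsSMulRegular N f)
    {d₁ : (α → R) →ₗ[R] (β → R)} {d₂ : (β → R) →ₗ[R] (γ → R)} {d₃ : (γ → R) →ₗ[R] N}
    (h₁₂ : Exact d₁ d₂) (h₂₃ : Exact d₂ d₃) :
    Exact (piBaseChange φ d₁) (piBaseChange φ d₂) := by
  have hφf : φ f = 0 := by
    rw [← RingHom.mem_ker, hf]
    exact Ideal.mem_span_singleton_self f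
  refine hφ.comp_left.forall.2 fun z ↦ ⟨fun hz ↦ ?_, ?_⟩
  · rw [piBaseChange_comp_apply] at hz
    have hdvd (i : γ) : ∃ c, d₂ z i = f * c := by
      rw [← dvd_def, ← Ideal.mem_span_singleton, ← hf, RingHom.mem_ker]
      exact congr_fun hz i
    choose w hw using hdvd
    replace hw : d₂ z = f • w := funext hw
    obtain ⟨v, rfl⟩ := (h₂₃ w).1 <| hN.right_eq_zero_of_smul <| by
      rw [← map_smul, ← hw, h₂₃.apply_apply_eq_zero]
    obtain ⟨u, hu⟩ := (h₁₂ (z - f • v)).1 <| by rw [map_sub, map_smul, hw, sub_self]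
    refine ⟨φ ∘ u, ?_⟩
    rw [piBaseChange_comp_apply, hu]
    ext i
    simp [hφf]
  · rintro ⟨w, hw⟩
    obtain ⟨w, rfl⟩ := hφ.comp_left w
    rw [← hw, piBaseChange_comp_apply, piBaseChange_comp_apply, h₁₂.apply_apply_eq_zero]
    ext
    simp

end BaseChange

namespace FreeResolution

variable {R S : Type*} [CommRing R] [CommRing S] {J : Ideal R} (F : FreeResolution R J)

/-- The augmentation of a free resolution of an ideal, as a map to the free module of rank one,
so that it can be base changed. -/
def augPi : (Fin (F.rank 0) → R) →ₗ[R] (Unit → R) :=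
  LinearMap.pi fun _ ↦ J.subtype ∘ₗ F.aug

theorem augPi_apply (z : Fin (F.rank 0) → R) (i : Unit) : F.augPi z i = (F.aug z : R) := rfl

theorem exact_augPi : Exact (F.d 0) F.augPi := by
  refine F.exact_zero.comp_injective (LinearMap.pi fun _ : Unit ↦ J.subtype) ?_ rfl
  exact fun x y h ↦ Subtype.ext (congr_fun h ())

theorem ideal_map_eq_range (φ : R →+* S) :
    J.map φ = LinearMap.range (LinearMap.proj () ∘ₗ piBaseChange φ F.augPi) := by
  apply le_antisymm
  · refine Ideal.map_le_iff_le_comap.2 fun x hx ↦ ?_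
    obtain ⟨z, hz⟩ := F.aug_surjective ⟨x, hx⟩
    exact ⟨φ ∘ z, by simp [piBaseChange_comp_apply, augPi_apply, hz]⟩
  · rw [LinearMap.range_eq_map, ← (Pi.basisFun S _).span_eq, Submodule.map_span_le]
    rintro _ ⟨i, rfl⟩
    have hsingle : Pi.basisFun S _ i = φ ∘ Pi.basisFun R _ i := by
      ext j
      simp [Pi.single_apply, apply_ite φ]
    rw [hsingle, LinearMap.comp_apply, piBaseChange_comp_apply]
    exact Ideal.mem_map_of_mem _ (F.aug _).2

theorem exists_baseChange (φ : R →+* S)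
    (h_aug : Exact (piBaseChange φ (F.d 0)) (piBaseChange φ F.augPi))
    (h_d : ∀ j, Exact (piBaseChange φ (F.d (j + 1))) (piBaseChange φ (F.d j))) :
    ∃ G : FreeResolution S (J.map φ), G.rank = F.rank := by
  have hmem (z) : (LinearMap.proj () ∘ₗ piBaseChange φ F.augPi) z ∈ J.map φ := by
    rw [F.ideal_map_eq_range φ]
    exact LinearMap.mem_range_self _ z
  exact ⟨{
    rank := F.rank
    d j := piBaseChange φ (F.d j)
    aug := (LinearMap.proj () ∘ₗ piBaseChange φ F.augPi).codRestrict _ hmem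
    aug_surjective := by
      rintro ⟨x, hx⟩
      obtain ⟨z, rfl⟩ := (F.ideal_map_eq_range φ).le hx
      exact ⟨z, rfl⟩
    exact_zero z := by
      rw [← h_aug z, Subtype.ext_iff, funext_iff, Unique.forall_iff]
      rfl
    exact_succ := h_d
    finite_length := F.finite_length }, rfl⟩

end FreeResolution

/-- Extension of scalars along `φ : R → S` turns free resolutions of the ideal `J` into free
resolutions of `J.map φ` of the same ranks. This is an elementary substitute for the condition
that `S` and `R ⧸ J` are Tor-independent over `R`. -/
def PreservesFreeResolutions {R S : Type*} [CommRing R] [CommRing S] (φ : R →+* S)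
    (J : Ideal R) : Prop :=
  ∀ F : FreeResolution R J, ∃ G : FreeResolution S (J.map φ), G.rank = F.rank

namespace PreservesFreeResolutions

variable {R S T : Type*} [CommRing R] [CommRing S] [CommRing T] {φ : R →+* S} {ψ : S →+* T}
  {J : Ideal R}

theorem comp (hψ : PreservesFreeResolutions ψ (J.map φ)) (hφ : PreservesFreeResolutions φ J) :
    PreservesFreeResolutions (ψ.comp φ) J := by
  intro F
  obtain ⟨G, hG⟩ := hφ F
  rw [← Ideal.map_map, ← hG]
  exact hψ G

theorem of_flat (hφ : φ.Flat) (J : Ideal R) : PreservesFreeResolutions φ J := fun F ↦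
  F.exists_baseChange φ (exact_piBaseChange_of_flat hφ F.exact_augPi)
    fun j ↦ exact_piBaseChange_of_flat hφ (F.exact_succ j)

theorem of_regular (hφ : Surjective φ) {f : R} (hf : RingHom.ker φ = Ideal.span {f})
    (hR : IsSMulRegular R f) (hJ : IsSMulRegular (R ⧸ J) f) : PreservesFreeResolutions φ J := by
  intro F
  have hpi (α : Type) : IsSMulRegular (α → R) f := .pi fun _ ↦ hR
  have exact_mkQ : Exact F.augPi (J.mkQ ∘ₗ LinearMap.proj () : (Unit → R) →ₗ[R] R ⧸ J) := by
    intro x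
    rw [LinearMap.comp_apply, Submodule.mkQ_apply, Submodule.Quotient.mk_eq_zero]
    constructor
    · intro hx
      obtain ⟨z, hz⟩ := F.aug_surjective ⟨x (), hx⟩
      exact ⟨z, funext fun _ ↦ congr($hz)⟩
    · rintro ⟨z, rfl⟩
      exact (F.aug z).2
  refine F.exists_baseChange φ (exact_piBaseChange_of_regular hφ hf hJ F.exact_augPi exact_mkQ) ?_
  rintro (_ | j)
  · exact exact_piBaseChange_of_regular hφ hf (hpi _) (F.exact_succ 0) F.exact_augPi
  · exact exact_piBaseChange_of_regular hφ hf (hpi _) (F.exact_succ (j + 1)) (F.exact_succ j)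

theorem bettiNumber_le (hφ : PreservesFreeResolutions φ J) (hJ : Nonempty (FreeResolution R J))
    (i : ℕ) : bettiNumber S (J.map φ) i ≤ bettiNumber R J i := by
  obtain ⟨F₀⟩ := hJ
  obtain ⟨F, hF⟩ : bettiNumber R J i ∈ {b | ∃ F : FreeResolution R J, F.rank i = b} :=
    Nat.sInf_mem ⟨_, F₀, rfl⟩
  obtain ⟨G, hG⟩ := hφ F
  exact Nat.sInf_le ⟨G, by rw [hG, hF]⟩

end PreservesFreeResolutions

section MonomialSubst

variable {σ ρ κ τ k : Type*}

theorem disjoint_finsupp_nat_iff {f g : σ →₀ ℕ} : Disjoint f g ↔ ∀ a, f a = 0 ∨ g a = 0 := by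
  simp [Finsupp.disjoint_iff, Finset.disjoint_left, or_iff_not_imp_left]

theorem disjoint_linearCombination {u : σ → ρ →₀ ℕ} {g : σ →₀ ℕ} {w : ρ →₀ ℕ}
    (h : ∀ a, g a = 0 ∨ Disjoint (u a) w) : Disjoint (Finsupp.linearCombination ℕ u g) w := by
  simp only [disjoint_finsupp_nat_iff] at *
  intro b
  refine or_iff_not_imp_right.2 fun hb ↦ ?_
  rw [Finsupp.linearCombination_apply, Finsupp.sum_apply]
  refine Finset.sum_eq_zero fun a _ ↦ ?_
  obtain ha | ha := h a
  · simp [ha]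
  · simp [(ha b).resolve_right hb]

/-- The homomorphism `k[x_a : a ∈ σ] → k[y_b : b ∈ ρ]` over `k` that substitutes the monomial
`y ^ u a` for the variable `x_a`. -/
noncomputable def monomialSubst (k : Type*) [CommSemiring k] (u : σ → ρ →₀ ℕ) :
    MvPolynomial σ k →+* MvPolynomial ρ k :=
  eval₂Hom C fun a ↦ monomial (u a) 1

theorem monomialSubst_C [CommSemiring k] (u : σ → ρ →₀ ℕ) (c : k) : monomialSubst k u (C c) = C c :=
  eval₂Hom_C _ _ _

theorem monomialSubst_X [CommSemiring k] (u : σ → ρ →₀ ℕ) (a : σ) :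
    monomialSubst k u (X a) = monomial (u a) 1 :=
  eval₂Hom_X' _ _ _

theorem monomialSubst_monomial [CommSemiring k] (u : σ → ρ →₀ ℕ) (e : σ →₀ ℕ) :
    monomialSubst k u (monomial e 1) = monomial (Finsupp.linearCombination ℕ u e) 1 := by
  simp only [monomialSubst, eval₂Hom_monomial, map_one, one_mul, Finsupp.linearCombination_apply,
    Finsupp.sum, Finsupp.prod, monomial_sum_one, monomial_pow, one_pow]

theorem map_monomialSubst_monomialIdeal [CommSemiring k] (u : σ → ρ →₀ ℕ) (s : Set (σ →₀ ℕ)) :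
    (monomialIdeal k s).map (monomialSubst k u) =
      monomialIdeal k (Finsupp.linearCombination ℕ u '' s) := by
  simp only [monomialIdeal, Ideal.map_span, Set.image_image, monomialSubst_monomial]

theorem monomialSubst_comp_monomialSubst [CommSemiring k] (v : ρ → κ →₀ ℕ) (u : σ → ρ →₀ ℕ) :
    (monomialSubst k v).comp (monomialSubst k u) =
      monomialSubst k fun a ↦ Finsupp.linearCombination ℕ v (u a) :=
  ringHom_ext (by simp [monomialSubst_C]) (by simp [monomialSubst_X, monomialSubst_monomial])

theorem monomialSubst_single [CommSemiring k] (f : σ → ρ) :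
    monomialSubst k (fun a ↦ Finsupp.single (f a) 1) = (rename f).toRingHom :=
  ringHom_ext (by simp [monomialSubst_C]) (by simp [monomialSubst_X, ← X.eq_def])

variable [CommRing k]

theorem mem_monomialIdeal_of_X_sub_monomial_mul_mem {s : Set (σ →₀ ℕ)} {a : σ} {w : σ →₀ ℕ}
    (hs : ∀ g ∈ s, Disjoint g w) (ha : w a = 0) {p : MvPolynomial σ k}
    (hp : (X a - monomial w 1) * p ∈ monomialIdeal k s) : p ∈ monomialIdeal k s := by
  have le_of_le_add {g e : σ →₀ ℕ} (hg : g ∈ s) (hge : g ≤ w + e) : g ≤ e := by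
    intro b
    have hgb := hge b
    have hgw := disjoint_finsupp_nat_iff.1 (hs g hg) b
    rw [Finsupp.add_apply] at hgb
    omega
  rw [mem_monomialIdeal] at hp ⊢
  intro e he
  induction hn : e a using Nat.strong_induction_on generalizing e with
  | _ n ih =>
    by_cases h : w + e ∈ ((X a - monomial w 1) * p).support
    · obtain ⟨g, hg, hge⟩ := hp _ h
      exact ⟨g, hg, le_of_le_add hg hge⟩
    · -- The term `x ^ (w + e)` of `x ^ w * p` cancels against the term `x ^ e'` of `p` times `x_a`.
      classical
      rw [notMem_support_iff, sub_mul, coeff_sub, coeff_monomial_mul, one_mul, sub_eq_zero,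
        coeff_X_mul'] at h
      rw [mem_support_iff, ← h, ite_ne_right_iff, Finsupp.mem_support_iff] at he
      set e' := w + e - Finsupp.single a 1
      have hn₀ : n ≠ 0 := by simpa [ha, hn] using he.1
      have he'a : e' a = n - 1 := by simp [e', ha, hn]
      obtain ⟨g, hg, hge⟩ := ih _ (by omega) e' (mem_support_iff.2 he.2) he'a
      exact ⟨g, hg, le_of_le_add hg (hge.trans tsub_le_self)⟩

theorem flat_rename {f : σ → ρ} (hf : Injective f) :
    (rename f : MvPolynomial σ k →ₐ[k] MvPolynomial ρ k).toRingHom.Flat := by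
  classical
  let e : ↥(Set.range f)ᶜ ⊕ σ ≃ ρ := (Equiv.sumComm _ _).trans <|
    ((Equiv.ofInjective f hf).sumCongr (.refl _)).trans (Equiv.Set.sumCompl (Set.range f))
  have flat_C : (C : MvPolynomial σ k →+* MvPolynomial ↥(Set.range f)ᶜ (MvPolynomial σ k)).Flat :=
    RingHom.flat_algebraMap_iff.2 inferInstance
  let ψ := (sumRingEquiv k ↥(Set.range f)ᶜ σ).symm.trans (renameEquiv k e).toRingEquiv
  have hψ : (rename f : MvPolynomial σ k →ₐ[k] MvPolynomial ρ k).toRingHom =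
      ψ.toRingHom.comp C :=
    ringHom_ext (by simp [ψ, sumRingEquiv_symm_C_C]) (by simp [ψ, sumRingEquiv_symm_C_X, e])
  rw [hψ]
  exact flat_C.comp (.of_bijective ψ.bijective)

variable {v : σ → ρ →₀ ℕ} {j : ρ → σ} {a : σ}

theorem leftInverse_monomialSubst_rename (hv : ∀ b, v (j b) = Finsupp.single b 1) :
    LeftInverse (monomialSubst k v) (rename j) := by
  have h : (monomialSubst k v).comp (rename j).toRingHom = RingHom.id _ :=
    ringHom_ext (by simp [monomialSubst_C]) (by simp [monomialSubst_X, hv, ← X.eq_def])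
  exact DFunLike.congr_fun h

theorem ker_monomialSubst (hv : ∀ b, v (j b) = Finsupp.single b 1) (hj : Set.range j = {a}ᶜ) :
    RingHom.ker (monomialSubst k v) =
      Ideal.span {X a - monomial ((v a).mapDomain j) 1} := by
  set I := Ideal.span {X a - monomial ((v a).mapDomain j) (1 : k)}
  have mk_comp : ((Ideal.Quotient.mk I).comp (rename j).toRingHom).comp (monomialSubst k v) =
      Ideal.Quotient.mk I := by
    refine ringHom_ext (by simp [monomialSubst_C]) fun x ↦ ?_
    rw [RingHom.comp_apply, monomialSubst_X]
    obtain rfl | hx := eq_or_ne x a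
    · symm
      refine Ideal.Quotient.eq.2 ?_
      rw [AlgHom.toRingHom_eq_coe, AlgHom.coe_toRingHom, rename_monomial]
      exact Ideal.mem_span_singleton_self _
    · obtain ⟨b, rfl⟩ : x ∈ Set.range j := hj ▸ hx
      simp [hv, ← X.eq_def]
  refine le_antisymm (fun p hp ↦ ?_) ?_
  · rw [← Ideal.Quotient.eq_zero_iff_mem, ← mk_comp, RingHom.comp_apply, hp, map_zero]
  · rw [Ideal.span_singleton_le_iff_mem, RingHom.mem_ker, map_sub, monomialSubst_X,
      ← rename_monomial, leftInverse_monomialSubst_rename hv, sub_self]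

theorem preservesFreeResolutions_monomialSubst_of_section (hv : ∀ b, v (j b) = Finsupp.single b 1)
    (hj : Set.range j = {a}ᶜ) {s : Set (σ →₀ ℕ)}
    (hs : ∀ g ∈ s, Disjoint g ((v a).mapDomain j)) :
    PreservesFreeResolutions (monomialSubst k v) (monomialIdeal k s) := by
  have ha : (v a).mapDomain j a = 0 := Finsupp.mapDomain_of_notMem_range _ _ (by simp [hj])
  refine .of_regular (leftInverse_monomialSubst_rename hv).surjective (ker_monomialSubst hv hj)
    (isSMulRegular_iff_right_eq_zero_of_smul.2 fun p hp ↦ ?_)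
    ((isSMulRegular_quotient_iff_mem_of_smul_mem _ _).2 fun p ↦
      mem_monomialIdeal_of_X_sub_monomial_mul_mem hs ha)
  rw [← Ideal.mem_bot, ← monomialIdeal_empty] at hp ⊢
  exact mem_monomialIdeal_of_X_sub_monomial_mul_mem (by simp) ha hp

section AdjoinedVariables

variable {n : ℕ}

/-- The exponents of the substitution that eliminates the first of `n + 1` variables adjoined to
those indexed by `ρ`, by replacing it with the monomial `y ^ w`. -/
noncomputable def elimFirst (n : ℕ) (w : ρ →₀ ℕ) : ρ ⊕ Fin (n + 1) → ρ ⊕ Fin n →₀ ℕ :=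
  Sum.elim (fun b ↦ Finsupp.single (.inl b) 1)
    (Fin.cons (w.mapDomain Sum.inl) fun a ↦ Finsupp.single (.inr a) 1)

theorem elimFirst_map_succ (w : ρ →₀ ℕ) (x : ρ ⊕ Fin n) :
    elimFirst n w (x.map id Fin.succ) = Finsupp.single x 1 := by
  obtain b | a := x <;> simp [elimFirst]

theorem monomialSubst_comp_elimFirst (u : Fin (n + 1) → ρ →₀ ℕ) :
    (monomialSubst k (Sum.elim (Finsupp.single · 1) (u ∘ Fin.succ))).comp
      (monomialSubst k (elimFirst n (u 0))) =
      monomialSubst k (Sum.elim (Finsupp.single · 1) u) := by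
  rw [monomialSubst_comp_monomialSubst]
  congr 1
  ext1 (b | a)
  · simp [elimFirst]
  · cases a using Fin.cases with
    | zero =>
      rw [elimFirst, Sum.elim_inr, Fin.cons_zero, Finsupp.linearCombination_mapDomain,
        Sum.elim_comp_inl]
      simp only [Finsupp.linearCombination_apply, Finsupp.smul_single_one, Finsupp.sum_single,
        Sum.elim_inr]
    | succ a => simp [elimFirst]

theorem preservesFreeResolutions_elimFirst {w : ρ →₀ ℕ} {s : Set (ρ ⊕ Fin (n + 1) →₀ ℕ)}
    (hs : ∀ g ∈ s, Disjoint g (w.mapDomain Sum.inl)) :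
    PreservesFreeResolutions (monomialSubst k (elimFirst n w)) (monomialIdeal k s) := by
  have range_eq : Set.range (Sum.map (id : ρ → ρ) (Fin.succ (n := n))) = {Sum.inr 0}ᶜ := by
    ext (b | a)
    · simp
    · cases a using Fin.cases <;> simp
  refine preservesFreeResolutions_monomialSubst_of_section (elimFirst_map_succ w) range_eq ?_
  have map_comp_inl : Sum.map id (Fin.succ (n := n)) ∘ Sum.inl = (Sum.inl : ρ → _) := rfl
  rwa [elimFirst, Sum.elim_inr, Fin.cons_zero, ← Finsupp.mapDomain_comp, map_comp_inl]

theorem disjoint_single_inr_mapDomain_inl (a : τ) (w : ρ →₀ ℕ) :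
    Disjoint (Finsupp.single (Sum.inr a) 1) (w.mapDomain (Sum.inl (β := τ))) :=
  disjoint_finsupp_nat_iff.2 (by rintro (b | c) <;> simp [Finsupp.mapDomain_of_notMem_range])

theorem disjoint_linearCombination_elimFirst {w w' : ρ →₀ ℕ} {g : ρ ⊕ Fin (n + 1) →₀ ℕ}
    (hw : Disjoint w w') (hg : Disjoint g (w'.mapDomain Sum.inl)) :
    Disjoint (Finsupp.linearCombination ℕ (elimFirst n w) g) (w'.mapDomain Sum.inl) := by
  refine disjoint_linearCombination ?_
  rintro (b | a)
  · have hgb := disjoint_finsupp_nat_iff.1 hg (.inl b)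
    rw [Finsupp.mapDomain_apply Sum.inl_injective] at hgb
    refine hgb.imp_right fun hb ↦ disjoint_finsupp_nat_iff.2 fun x ↦ ?_
    obtain rfl | hx := eq_or_ne x (.inl b)
    · exact .inr (by rwa [Finsupp.mapDomain_apply Sum.inl_injective])
    · exact .inl (Finsupp.single_eq_of_ne hx)
  · right
    cases a using Fin.cases with
    | zero =>
      refine disjoint_finsupp_nat_iff.2 ?_
      rintro (b | c)
      · simpa [elimFirst, Finsupp.mapDomain_apply Sum.inl_injective] using
          disjoint_finsupp_nat_iff.1 hw b
      · exact .inr (Finsupp.mapDomain_of_notMem_range _ _ (by simp))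
    | succ a => exact disjoint_single_inr_mapDomain_inl a w'

theorem preservesFreeResolutions_monomialSubst_sumElim {u : Fin n → ρ →₀ ℕ}
    (hu : Pairwise (Disjoint on u)) {s : Set (ρ ⊕ Fin n →₀ ℕ)}
    (hs : ∀ g ∈ s, ∀ a, Disjoint g ((u a).mapDomain Sum.inl)) :
    PreservesFreeResolutions (monomialSubst k (Sum.elim (Finsupp.single · 1) u))
      (monomialIdeal k s) := by
  induction n with
  | zero =>
    have h : Sum.elim (Finsupp.single · 1) u =
        fun x ↦ Finsupp.single (Equiv.sumEmpty ρ (Fin 0) x) 1 := by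
      ext1 (b | a)
      · rfl
      · exact a.elim0
    rw [h, monomialSubst_single]
    exact .of_flat (flat_rename (Equiv.injective _)) _
  | succ n ih =>
    rw [← monomialSubst_comp_elimFirst]
    refine .comp ?_ (preservesFreeResolutions_elimFirst fun g hg ↦ hs g hg 0)
    rw [map_monomialSubst_monomialIdeal]
    refine ih (hu.comp_of_injective (Fin.succ_injective n)) ?_
    rintro _ ⟨g, hg, rfl⟩ a
    exact disjoint_linearCombination_elimFirst (hu (Fin.succ_ne_zero a).symm) (hs g hg a.succ)

end AdjoinedVariables

theorem preservesFreeResolutions_monomialSubst [Finite τ] {u : τ → ρ →₀ ℕ}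
    (hu : Pairwise (Disjoint on u)) (s : Set (τ →₀ ℕ)) :
    PreservesFreeResolutions (monomialSubst k u) (monomialIdeal k s) := by
  obtain ⟨n, ⟨e⟩⟩ := Finite.exists_equiv_fin τ
  let ι : τ → ρ ⊕ Fin n := Sum.inr ∘ e
  have h_comp : (monomialSubst k (Sum.elim (Finsupp.single · 1) (u ∘ e.symm))).comp
      (monomialSubst k fun a ↦ Finsupp.single (ι a) 1) = monomialSubst k u := by
    rw [monomialSubst_comp_monomialSubst]
    simp [ι]
  rw [← h_comp]
  refine .comp ?_ ?_
  · rw [map_monomialSubst_monomialIdeal]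
    refine preservesFreeResolutions_monomialSubst_sumElim
      (hu.comp_of_injective e.symm.injective) ?_
    rintro _ ⟨g, -, rfl⟩ a
    exact disjoint_linearCombination fun x ↦ .inr (disjoint_single_inr_mapDomain_inl (e x) _)
  · rw [monomialSubst_single]
    exact .of_flat (flat_rename (Sum.inr_injective.comp e.injective)) _

end MonomialSubst

section ExtremalIdeal

variable (k : Type*) {σ : Type*}

theorem prod_X_eq_monomial [CommSemiring k] (s : Finset σ) :
    ∏ x ∈ s, X x = monomial (∑ x ∈ s, Finsupp.single x 1) (1 : k) :=
  (monomial_sum_one s _).symm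

variable [Field k]

theorem exists_extremalIdeal_pow_eq_monomialIdeal (q r : ℕ) :
    ∃ s : Set (ExtremalVar q →₀ ℕ), s.Finite ∧ extremalIdeal k q ^ r = monomialIdeal k s := by
  have h : extremalIdeal k q = monomialIdeal k (Set.range fun j : Fin q ↦
      ∑ A : ExtremalVar q with j ∈ A.1, Finsupp.single A 1) := by
    rw [extremalIdeal, monomialIdeal, ← Set.range_comp]
    exact congr(Ideal.span (Set.range $(funext fun j ↦ prod_X_eq_monomial k _)))
  rw [h]
  exact exists_monomialIdeal_pow_eq (Set.finite_range _) r

variable {k}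

theorem exists_map_monomialSubst_extremalIdeal {q : ℕ} {m : Fin q → MvPolynomial σ k}
    (hm : ∀ j, IsSquarefreeMonomial (m j)) :
    ∃ u : ExtremalVar q → σ →₀ ℕ, Pairwise (Disjoint on u) ∧
      (extremalIdeal k q).map (monomialSubst k u) = Ideal.span (Set.range m) := by
  classical
  choose s hs using hm
  let pattern (x : σ) : Finset (Fin q) := {j | x ∈ s j}
  let block (A : ExtremalVar q) : Finset σ := {x ∈ Finset.univ.biUnion s | pattern x = A.1}
  have disjoint_block : Pairwise (Disjoint on block) := fun A B hAB ↦
    Finset.disjoint_filter.2 fun x _ hA hB ↦ hAB (Subtype.ext (hA.symm.trans hB))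
  have biUnion_block (j : Fin q) :
      ({A : ExtremalVar q | j ∈ A.1} : Finset _).biUnion block = s j := by
    ext x
    simp only [Finset.mem_biUnion, Finset.mem_filter, Finset.mem_univ, true_and, block]
    constructor
    · rintro ⟨A, hjA, -, hA⟩
      simpa [pattern, ← hA] using hjA
    · intro hx
      have hj : j ∈ pattern x := by simpa [pattern] using hx
      exact ⟨⟨pattern x, j, hj⟩, hj, ⟨j, hx⟩, rfl⟩
  refine ⟨fun A ↦ ∑ x ∈ block A, Finsupp.single x 1, fun A B hAB ↦ ?_, ?_⟩
  · refine disjoint_finsupp_nat_iff.2 fun x ↦ ?_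
    have not_mem_both : x ∈ block A → x ∉ block B := fun h ↦
      Finset.disjoint_left.1 (disjoint_block hAB) h
    simpa [Finsupp.finsetSum_apply, Finsupp.single_apply, or_iff_not_imp_left] using not_mem_both
  · rw [extremalIdeal, Ideal.map_span, ← Set.range_comp]
    refine congr(Ideal.span (Set.range $(funext fun j ↦ ?_)))
    simp only [Function.comp_apply, extremalMonomial, map_prod, monomialSubst_X,
      ← prod_X_eq_monomial]
    rw [← Finset.prod_biUnion (disjoint_block.set_pairwise _), biUnion_block, hs]

theorem theorem7p6_general {q : ℕ} (m : Fin q → MvPolynomial σ k)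
    (hm : ∀ j, IsSquarefreeMonomial (m j)) (r i : ℕ) :
    bettiNumber (MvPolynomial σ k) ↥(Ideal.span (Set.range m) ^ r) i ≤
      bettiNumber (ExtremalRing k q) ↥(extremalIdeal k q ^ r) i := by
  obtain ⟨u, hu, map_eq⟩ := exists_map_monomialSubst_extremalIdeal hm
  obtain ⟨s, hs, pow_eq⟩ := exists_extremalIdeal_pow_eq_monomialIdeal k q r
  rw [← map_eq, ← Ideal.map_pow, pow_eq]
  exact (preservesFreeResolutions_monomialSubst hu s).bettiNumber_le
    (hasFiniteFreeResolution_monomialIdeal hs).nonempty_freeResolution i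

end ExtremalIdeal

theorem theorem7p6 (k : Type*) [Field k] (r q : ℕ) (hr : 0 < r) (hq : 0 < q)
    (n : ℕ) (I : Ideal (MvPolynomial (Fin n) k))
    (hI : IsMinimallyGeneratedBySquarefreeMonomials I q) (i : ℕ) :
    bettiNumber (MvPolynomial (Fin n) k) ↥(I ^ r) i ≤
      bettiNumber (ExtremalRing k q) ↥(extremalIdeal k q ^ r) i := by
  obtain ⟨m, hm, rfl, -⟩ := hI
  exact theorem7p6_general m hm r i
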